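/- For an integer $p\ge 3$ let $\lambda_p=2\cos(\pi/p)$. An infinite frieze pattern is an array of real numbers $(m_{i,j})_{i,j\in\mathbb Z,\ j\ge i}$ with $m_{i,i}=0$ and $m_{i,i+1}=1$ for all $i$, such that $m_{i-1,j}\,m_{i,j+1}-m_{i,j}\,m_{i-1,j+1}=1$ for all $i\le j$. Let $S$ be either an annulus $A_{n,m}$ with $n\ge1$ marked points on the outer boundary and $m\ge1$ marked points on the inner boundary, or a once-punctured disc $S_n$ with $n\ge 1$ marked points on the boundary, the puncture also being a marked point. Let $v_1,\dots,v_n$ be the marked points on the (outer) boundary in counterclockwise order, with indices read modulo $n$. A dissection $\mathcal D$ of $S$ is a set of pairwise non-crossing arcs between marked points (up to isotopy) which divides $S$ into polygons, called subgons. For a subgon $P$ let $|P|$ be its number of edges, an edge that bounds $P$ on both sides being counted twice. Let $A_i$ be the multiset of the sizes $|P|$ of the subgons met by a small half circle around $v_i$ in $S$, a subgon being counted as often as the half circle passes through it. The infinite frieze pattern $(m_{i,j})$ is said to come from $\mathcal D$ if $m_{i-1,i+1}=\sum_{p\in A_i}\lambda_p$ for all $i\in\mathbb Z$. **Corollary.**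 If $(m_{i,j})$ is an infinite frieze pattern that comes from a dissection of an annulus $A_{n,m}$ or of a once-punctured disc $S_n$, then $m_{i,j}>0$ for all $i<j$. -/

import Mathlib

open Set

/-- `λ_p = 2 cos (π / p)`. -/
noncomputable def lam (p : ℕ) : ℝ := 2 * Real.cos (Real.pi / p)

/-- An infinite frieze pattern `(F i j)`, `i ≤ j`, over a commutative ring: a row of zeros, a row of
ones, and the unimodular rule `left * right - top * bottom = 1` on every diamond with top `F i j`,
left `F (i - 1) j`, right `F i (j + 1)` and bottom `F (i - 1) (j + 1)`.
Values `F i j` with `j < i` are irrelevant. -/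
structure IsInfiniteFrieze {R : Type*} [CommRing R] (F : ℤ → ℤ → R) : Prop where
  zero_row : ∀ i, F i i = 0
  one_row : ∀ i, F i (i + 1) = 1
  unimodular : ∀ i j, i ≤ j → F (i - 1) j * F i (j + 1) - F i j * F (i - 1) (j + 1) = 1

section Strip

variable {V : Type*} [LinearOrder V]

/-- A chord `e` (with `e.1 < e.2`) of a disc whose boundary points `V` are listed in their order
along the boundary crosses the chord between `x` and `y`: one of `x`, `y` lies strictly between the
ends of `e`, and the other one strictly on the other side. -/
def Crosses (e : V × V) (x y : V) : Prop :=
  (x ∈ Ioo e.1 e.2 ∧ y ∉ Icc e.1 e.2) ∨ (y ∈ Ioo e.1 e.2 ∧ x ∉ Icc e.1 e.2)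

/-- A subgon cut out by a set of non-crossing chords, given by its set of vertices: a maximal set of
marked points no two of which are separated by a chord. -/
def IsSubgon (arcs : Set (V × V)) (P : Set V) : Prop :=
  Maximal (fun Q : Set V => ∀ x ∈ Q, ∀ y ∈ Q, ∀ e ∈ arcs, ¬ Crosses e x y) P

/-- A dissection of a surface whose universal cover is a strip with marked points `V` and deck
translation `T`, given by all lifts of its arcs, up to isotopy. A lift of an arc is a chord between
two marked points that are not neighbours on the boundary (otherwise it would be isotopic to a
boundary segment). The set of lifts is invariant under `T`; the arcs do not cross themselves or one
another; and the pieces into which they cut the surface are polygons. -/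
structure StripDissection (T : V → V) where
  arcs : Set (V × V)
  isArc : ∀ e ∈ arcs, e.1 < e.2 ∧ ¬ e.1 ⋖ e.2
  periodic : ∀ x y, (T x, T y) ∈ arcs ↔ (x, y) ∈ arcs
  noncrossing : ∀ e ∈ arcs, ∀ f ∈ arcs, ¬ Crosses e f.1 f.2
  polygons : ∀ P, IsSubgon arcs P → P.Finite

/-- The sum of `λ_{|P|}` over the subgons `P` seen by a small half circle around a vertex. Counting
the (finitely many) subgons of the strip at a lift `v` of the vertex counts a subgon of the surface
once for each corner it has at that vertex, and the number of edges of a subgon is the number of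
vertices of its lift; so both sides of a self-folded subgon are counted. -/
noncomputable def StripDissection.quiddity {T : V → V} (D : StripDissection T) (v : V) : ℝ :=
  ∑ᶠ P ∈ {P : Set V | IsSubgon D.arcs P ∧ v ∈ P}, lam P.ncard

end Strip

/-- The marked points of the strip covering an annulus: lifts `outer i` of the outer vertices and
`inner j` of the inner ones, in their order along the boundary of the strip: the outer side is
followed from left to right and then the inner side from right to left. -/
abbrev AnnulusPoint : Type := ℤ ⊕ₗ ℤᵒᵈ

def AnnulusPoint.outer (i : ℤ) : AnnulusPoint := toLex (Sum.inl i)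

def AnnulusPoint.inner (j : ℤ) : AnnulusPoint := toLex (Sum.inr (OrderDual.toDual j))

/-- The deck translation of the strip covering the annulus with `n` outer and `m` inner vertices. -/
def annulusShift (n m : ℕ) (x : AnnulusPoint) : AnnulusPoint :=
  match ofLex x with
  | Sum.inl i => AnnulusPoint.outer (i + n)
  | Sum.inr j => AnnulusPoint.inner (OrderDual.ofDual j + m)

/-- Dissections of the annulus `A_{n,m}`. -/
abbrev AnnulusDissection (n m : ℕ) : Type := StripDissection (annulusShift n m)

/-- The deck translation of the strip of the once-punctured disc with `n` boundary vertices. Its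
marked points are the lifts `i : ℤ` of the boundary vertices and the puncture `⊤`, at which the
asymptotic arcs (the lifts of the arcs to the puncture) meet. -/
def discShift (n : ℕ) (x : WithTop ℤ) : WithTop ℤ := WithTop.map (fun i : ℤ => i + n) x

/-- Dissections of the once-punctured disc `S_n`. -/
abbrev PuncturedDiscDissection (n : ℕ) : Type := StripDissection (discShift n)

/-- `F` is an infinite frieze pattern arising from the dissection `D` of `A_{n,m}`, with respect to
the outer boundary, whose vertices are labelled cyclically by `ℤ` modulo `n`. -/
def IsFriezeOfAnnulus {n m : ℕ} (D : AnnulusDissection n m) (F : ℤ → ℤ → ℝ) : Prop :=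
  IsInfiniteFrieze F ∧ ∀ i : ℤ, F (i - 1) (i + 1) = D.quiddity (AnnulusPoint.outer i)

/-- `F` is an infinite frieze pattern arising from the dissection `D` of `S_n`. -/
def IsFriezeOfPuncturedDisc {n : ℕ} (D : PuncturedDiscDissection n) (F : ℤ → ℤ → ℝ) : Prop :=
  IsInfiniteFrieze F ∧ ∀ i : ℤ, F (i - 1) (i + 1) = D.quiddity (i : WithTop ℤ)

/-! The frieze is governed by the recurrence `x (k + 1) = a k * x k - x (k - 1)`, where `a` is its
quiddity row, so everything rests on the form `∑ a k * y k ^ 2 - 2 * ∑ y k * y (k + 1)` along the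
boundary. This form is a sum of local forms, one per subgon of the strip. A `p`-gon contributes `λ_p
* ∑ y v ^ 2`, minus twice the products over consecutive vertices in the linear order, plus twice the
product of its first and last vertex. An arc is a consecutive pair for the subgon beyond it and an
extreme pair for the subgon under it, so its two contributions cancel; a boundary segment occurs
only as a consecutive pair. The local form is that of a cycle with one edge of reversed sign. The
adjacency eigenvalues of this cycle are `2 cos ((2k+1)π/p)`, at most `λ_p`, so the form is positive
semidefinite (`twisted_cycle_nonneg`, proved by completing squares). Hence so is the global form
(`StripDissection.quadraticForm_nonneg`). Semidefiniteness makes all continuants positive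
(`continuant_pos`), and positivity lets the diamond rule determine the frieze from its quiddity row
(`IsInfiniteFrieze.eq_continuant`). Test vectors live on one boundary line, so local finiteness is
needed only there; infinitely many arcs may meet at the lifted puncture. -/

/-! ### The sign-twisted cycle -/

section TwistedCycle

/-- Energy estimate for an open chain in terms of its two end values. -/
theorem chain_energy_bound {p : ℕ} (z : ℕ → ℝ) (m : ℕ) (hm : m + 2 ≤ p) :
    Real.sin ((m + 2) * (Real.pi / p)) * (z 0 ^ 2 + z (m + 1) ^ 2)
        - 2 * Real.sin (Real.pi / p) * z 0 * z (m + 1)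
      ≤ Real.sin ((m + 1) * (Real.pi / p)) *
        (lam p * ∑ k ∈ Finset.range (m + 2), z k ^ 2
          - 2 * ∑ k ∈ Finset.range (m + 1), z k * z (k + 1)) := by
  have hp : (0 : ℝ) < p := by
    have : 0 < p := by omega
    exact_mod_cast this
  unfold lam
  set θ := Real.pi / p with hθ
  have hθ0 : 0 < θ := div_pos Real.pi_pos hp
  have hpos : ∀ k : ℕ, k + 1 < p → 0 < Real.sin ((k + 1) * θ) := by
    intro k hk
    refine Real.sin_pos_of_pos_of_lt_pi (by positivity) ?_
    have h1 : ((k : ℝ) + 1) < p := by exact_mod_cast hk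
    calc ((k : ℝ) + 1) * θ < p * θ := by gcongr
      _ = Real.pi := by rw [hθ]; field_simp
  induction m with
  | zero =>
    have h2 : Real.sin ((((0 : ℕ) : ℝ) + 2) * θ) = 2 * Real.sin θ * Real.cos θ := by
      rw [← Real.sin_two_mul]; simp
    rw [h2]
    simp only [Finset.sum_range_succ, Finset.sum_range_zero, Nat.cast_zero, zero_add, one_mul]
    apply le_of_eq
    ring
  | succ m ih =>
    have ih := ih (by omega)
    have hs := hpos m (by omega)
    have hs' := hpos (m + 1) (by omega)
    rw [Finset.sum_range_succ _ (m + 2), Finset.sum_range_succ (fun k => z k * z (k + 1)) (m + 1)]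
    generalize (∑ k ∈ Finset.range (m + 2), z k ^ 2) = A at *
    generalize (∑ k ∈ Finset.range (m + 1), z k * z (k + 1)) = B at *
    push_cast at *
    have e1 : Real.sin (((m : ℝ) + 1 + 2) * θ)
        = 2 * Real.cos θ * Real.sin ((m + 2) * θ) - Real.sin ((m + 1) * θ) := by
      have a1 : ((m : ℝ) + 1 + 2) * θ = (m + 2) * θ + θ := by ring
      have a2 : ((m : ℝ) + 1) * θ = (m + 2) * θ - θ := by ring
      rw [a1, a2, Real.sin_add, Real.sin_sub]; ring
    have e2 : Real.sin (((m : ℝ) + 2) * θ) ^ 2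
        - Real.sin ((m + 1) * θ) * Real.sin ((m + 1 + 2) * θ) = Real.sin θ ^ 2 := by
      have a1 : ((m : ℝ) + 1 + 2) * θ = (m + 2) * θ + θ := by ring
      have a2 : ((m : ℝ) + 1) * θ = (m + 2) * θ - θ := by ring
      rw [a1, a2, Real.sin_add, Real.sin_sub]
      have c1 := Real.sin_sq_add_cos_sq (((m : ℝ) + 2) * θ)
      have c2 := Real.sin_sq_add_cos_sq θ
      linear_combination (Real.sin (((m : ℝ) + 2) * θ)) ^ 2 * (-c2)
        + (Real.sin θ) ^ 2 * c1
    have e3 : ((m : ℝ) + 1 + 1) = m + 2 := by ring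
    rw [e3] at hs' ⊢
    generalize Real.sin (((m : ℝ) + 1 + 2) * θ) = s3 at *
    generalize Real.sin (((m : ℝ) + 2) * θ) = s2 at *
    generalize Real.sin (((m : ℝ) + 1) * θ) = s1 at *
    generalize Real.sin θ = s at *
    generalize Real.cos θ = c at *
    -- The new interior value is `z (m + 1)`. The square vanishes where it is interpolated from the
    -- ends `z 0`, `z (m + 2)` by the solution of `x (k + 1) + x (k - 1) = 2 cos θ * x k`.
    have hsq := sq_nonneg (s2 * z (m + 1) - s1 * z (m + 1 + 1) - s * z 0)
    have hmul := mul_le_mul_of_nonneg_left ih hs'.le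
    refine le_of_mul_le_mul_left ?_ hs
    have key : s1 * (s2 * (2 * c * (A + z (m + 2) ^ 2) - 2 * (B + z (m + 1) * z (m + 1 + 1))))
        - s1 * (s3 * (z 0 ^ 2 + z (m + 1 + 1) ^ 2) - 2 * s * z 0 * z (m + 1 + 1))
        = (s2 * z (m + 1) - s1 * z (m + 1 + 1) - s * z 0) ^ 2
          + (s2 * (s1 * (2 * c * A - 2 * B))
          - s2 * (s2 * (z 0 ^ 2 + z (m + 1) ^ 2) - 2 * s * z 0 * z (m + 1))) := by
      linear_combination (z 0 ^ 2) * e2 - s1 * (z (m + 2)) ^ 2 * e1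
    linarith

/-- The quadratic form of a cycle of length `p` with one edge of opposite sign is positive
semidefinite when the diagonal entries are `λ_p`. -/
theorem twisted_cycle_nonneg (z : ℕ → ℝ) (m : ℕ) :
    0 ≤ lam (m + 2) * ∑ k ∈ Finset.range (m + 2), z k ^ 2
      - 2 * ∑ k ∈ Finset.range (m + 1), z k * z (k + 1) + 2 * (z 0 * z (m + 1)) := by
  have h := chain_energy_bound (p := m + 2) z m le_rfl
  have hp : (0 : ℝ) < m + 2 := by positivity
  push_cast at h
  -- At full length the coefficient of the end squares is `sin π = 0`, and the two other sines both
  -- equal `sin (π / p) > 0`, which cancels.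
  have h2 : ((m : ℝ) + 2) * (Real.pi / (m + 2)) = Real.pi := by field_simp
  have h1 : ((m : ℝ) + 1) * (Real.pi / (m + 2)) = Real.pi - Real.pi / (m + 2) := by
    field_simp; ring
  rw [h2, h1, Real.sin_pi, Real.sin_pi_sub] at h
  have hs : 0 < Real.sin (Real.pi / (m + 2)) := by
    refine Real.sin_pos_of_pos_of_lt_pi (by positivity) ?_
    rw [div_lt_iff₀ hp]
    nlinarith [Real.pi_pos]
  refine nonneg_of_mul_nonneg_right (a := Real.sin (Real.pi / (m + 2))) ?_ hs
  linarith

end TwistedCycle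

/-! ### The quadratic form of one polygon -/

section PolygonForm

variable {V : Type*} [LinearOrder V]

/-- The vertices of a polygon that see `u < v` as consecutive vertices. -/
def SpansOutside (P : Set V) (u v : V) : Prop := u < v ∧ u ∈ P ∧ v ∈ P ∧ ∀ w ∈ P, w ∉ Ioo u v

/-- `u < v` are the extreme vertices of a polygon. -/
def SpansInside (P : Set V) (u v : V) : Prop := u < v ∧ u ∈ P ∧ v ∈ P ∧ ∀ w ∈ P, w ∈ Icc u v

theorem exists_enumeration (P : Finset V) (hP : P.Nonempty) :
    ∃ f : ℕ → V, (∀ i < P.card, ∀ j < P.card, (f i < f j ↔ i < j)) ∧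
      P = (Finset.range P.card).image f := by
  obtain ⟨a, -⟩ := hP
  refine ⟨fun k => if h : k < P.card then P.orderEmbOfFin rfl ⟨k, h⟩ else a, ?_, ?_⟩
  · intro i hi j hj
    simp [hi, hj]
  · ext x
    simp only [Finset.mem_image, Finset.mem_range]
    constructor
    · intro hx
      have : x ∈ Set.range (P.orderEmbOfFin rfl) := by simpa using hx
      obtain ⟨k, rfl⟩ := this
      exact ⟨k, k.2, by simp⟩
    · rintro ⟨k, hk, rfl⟩
      simp [hk]

open Classical in
/-- The quadratic form attached to a polygon in a linearly ordered set is positive semidefinite. -/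
theorem polygon_form_nonneg (P : Finset V) (hP : 2 ≤ P.card) (y : V → ℝ) :
    0 ≤ lam P.card * ∑ v ∈ P, y v ^ 2
      - 2 * ∑ u ∈ P, ∑ v ∈ P, (if SpansOutside (P : Set V) u v then y u * y v else 0)
      + 2 * ∑ u ∈ P, ∑ v ∈ P, (if SpansInside (P : Set V) u v then y u * y v else 0) := by
  obtain ⟨f, hf, hPf⟩ := exists_enumeration P (Finset.card_pos.mp (by omega))
  obtain ⟨m, hm⟩ : ∃ m, P.card = m + 2 := ⟨P.card - 2, by omega⟩
  rw [hm] at hf hPf ⊢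
  have hinj : Set.InjOn f (Finset.range (m + 2) : Set ℕ) := by
    intro i hi j hj hij
    simp only [Finset.coe_range, Set.mem_Iio] at hi hj
    have h1 := hf i hi j hj
    have h2 := hf j hj i hi
    rw [hij] at h1 h2
    simp only [lt_self_iff_false, false_iff] at h1 h2
    omega
  have hmem : ∀ x, x ∈ (P : Set V) ↔ ∃ k < m + 2, f k = x := by
    intro x
    rw [hPf]; simp
  have hle : ∀ i < m + 2, ∀ j < m + 2, (f i ≤ f j ↔ i ≤ j) := by
    intro i hi j hj
    rw [← not_lt, hf j hj i hi, not_lt]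
  have hout : ∀ i < m + 2, ∀ j < m + 2, (SpansOutside (P : Set V) (f i) (f j) ↔ j = i + 1) := by
    intro i hi j hj
    constructor
    · rintro ⟨h, -, -, h2⟩
      rw [hf i hi j hj] at h
      by_contra hne
      refine h2 (f (i + 1)) ((hmem _).2 ⟨i + 1, by omega, rfl⟩) ⟨?_, ?_⟩
      · rw [hf i hi _ (by omega)]; omega
      · rw [hf _ (by omega) j hj]; omega
    · rintro rfl
      refine ⟨(hf _ hi _ hj).2 (by omega), (hmem _).2 ⟨_, hi, rfl⟩, (hmem _).2 ⟨_, hj, rfl⟩, ?_⟩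
      rintro w hw ⟨h1, h2⟩
      obtain ⟨k, hk, rfl⟩ := (hmem w).1 hw
      rw [hf _ hi _ hk] at h1
      rw [hf _ hk _ hj] at h2
      omega
  have hin : ∀ i < m + 2, ∀ j < m + 2,
      (SpansInside (P : Set V) (f i) (f j) ↔ i = 0 ∧ j = m + 1) := by
    intro i hi j hj
    constructor
    · rintro ⟨-, -, -, h2⟩
      have h3 := (h2 (f 0) ((hmem _).2 ⟨0, by omega, rfl⟩)).1
      have h4 := (h2 (f (m + 1)) ((hmem _).2 ⟨m + 1, by omega, rfl⟩)).2
      rw [hle _ hi _ (by omega)] at h3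
      rw [hle _ (by omega) _ hj] at h4
      omega
    · rintro ⟨rfl, rfl⟩
      refine ⟨(hf _ hi _ hj).2 (by omega), (hmem _).2 ⟨_, hi, rfl⟩, (hmem _).2 ⟨_, hj, rfl⟩, ?_⟩
      intro w hw
      obtain ⟨k, hk, rfl⟩ := (hmem w).1 hw
      exact ⟨(hle _ hi _ hk).2 (by omega), (hle _ hk _ hj).2 (by omega)⟩
  have hsum : ∀ g : V → ℝ, ∑ v ∈ P, g v = ∑ k ∈ Finset.range (m + 2), g (f k) := by
    intro g
    conv_lhs => rw [hPf]
    exact Finset.sum_image hinj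
  have hsum_out : ∑ u ∈ P, ∑ v ∈ P, (if SpansOutside (P : Set V) u v then y u * y v else 0)
      = ∑ k ∈ Finset.range (m + 1), y (f k) * y (f (k + 1)) := by
    have h1 : ∑ u ∈ P, ∑ v ∈ P, (if SpansOutside (P : Set V) u v then y u * y v else 0)
        = ∑ i ∈ Finset.range (m + 2), ∑ j ∈ Finset.range (m + 2),
          (if j = i + 1 then y (f i) * y (f j) else 0) := by
      rw [hsum]
      refine Finset.sum_congr rfl fun i hi => ?_
      rw [hsum]
      refine Finset.sum_congr rfl fun j hj => ?_
      simp only [hout i (Finset.mem_range.1 hi) j (Finset.mem_range.1 hj)]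
    rw [h1]
    simp only [Finset.sum_ite_eq', Finset.mem_range]
    rw [Finset.sum_range_succ, if_neg (by omega), add_zero]
    refine Finset.sum_congr rfl fun i hi => ?_
    rw [if_pos (by have := Finset.mem_range.1 hi; omega)]
  have hsum_in : ∑ u ∈ P, ∑ v ∈ P, (if SpansInside (P : Set V) u v then y u * y v else 0)
      = y (f 0) * y (f (m + 1)) := by
    rw [hsum, Finset.sum_eq_single 0]
    · rw [hsum, Finset.sum_eq_single (m + 1)]
      · rw [if_pos ((hin 0 (by omega) (m + 1) (by omega)).2 ⟨rfl, rfl⟩)]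
      · intro j hj hne
        rw [if_neg]
        rw [hin 0 (by omega) j (Finset.mem_range.1 hj)]
        tauto
      · simp
    · intro i hi hne
      rw [hsum]
      refine Finset.sum_eq_zero fun j hj => ?_
      rw [if_neg]
      rw [hin i (Finset.mem_range.1 hi) j (Finset.mem_range.1 hj)]
      tauto
    · simp
  rw [hsum_out, hsum_in, hsum]
  exact twisted_cycle_nonneg (fun k => y (f k)) m

end PolygonForm

/-! ### Separation of points and subgons -/

section Subgons

variable {V : Type*} [LinearOrder V] {arcs : Set (V × V)}

/-- No two points of `Q` are separated by an arc. -/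
def Uncrossed (arcs : Set (V × V)) (Q : Set V) : Prop :=
  ∀ x ∈ Q, ∀ y ∈ Q, ∀ e ∈ arcs, ¬ Crosses e x y

theorem Crosses.symm {e : V × V} {x y : V} (h : Crosses e x y) : Crosses e y x := Or.symm h

theorem not_crosses_self (e : V × V) (x : V) : ¬ Crosses e x x := by
  rintro (⟨h, h'⟩ | ⟨h, h'⟩) <;> exact h' (Ioo_subset_Icc_self h)

theorem not_crosses_of_covBy {x y : V} (h : x ⋖ y) (e : V × V) : ¬ Crosses e x y := by
  rintro (⟨h1, h2⟩ | ⟨h1, h2⟩)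
  · exact h2 ⟨(h1.1.trans h.lt).le, h.ge_of_gt h1.2⟩
  · exact h2 ⟨h.le_of_lt h1.1, (h.lt.trans h1.2).le⟩

/-- Being unseparated is a condition on pairs, so it passes to unions of chains and Zorn's lemma
applies. -/
theorem Uncrossed.exists_subgon {Q : Set V} (h : Uncrossed arcs Q) :
    ∃ P, Q ⊆ P ∧ IsSubgon arcs P := by
  obtain ⟨P, hQP, hP⟩ := zorn_subset_nonempty {Q | Uncrossed arcs Q} (by
    intro c hc hchain hne
    refine ⟨⋃₀ c, ?_, fun s hs => subset_sUnion_of_mem hs⟩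
    rintro x ⟨s, hs, hx⟩ y ⟨t, ht, hy⟩
    rcases hchain.total hs ht with hst | hts
    · exact hc ht x (hst hx) y hy
    · exact hc hs x hx y (hts hy)) Q h
  exact ⟨P, hQP, hP⟩

theorem uncrossed_pair {u v : V} (h : ∀ e ∈ arcs, ¬ Crosses e u v) :
    Uncrossed arcs {u, v} := by
  rintro x (rfl | rfl) y (rfl | rfl) e he
  · exact not_crosses_self _ _
  · exact h e he
  · exact fun hc => h e he hc.symm
  · exact not_crosses_self _ _

theorem uncrossed_triple {u v w : V} (huv : ∀ e ∈ arcs, ¬ Crosses e u v)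
    (huw : ∀ e ∈ arcs, ¬ Crosses e u w) (hvw : ∀ e ∈ arcs, ¬ Crosses e v w) :
    Uncrossed arcs {u, v, w} := by
  rintro x (rfl | rfl | rfl) y (rfl | rfl | rfl) e he <;>
    first
    | exact not_crosses_self _ _
    | exact huv e he
    | exact huw e he
    | exact hvw e he
    | exact fun hc => huv e he hc.symm
    | exact fun hc => huw e he hc.symm
    | exact fun hc => hvw e he hc.symm

theorem IsSubgon.uncrossed {P : Set V} (hP : IsSubgon arcs P) : Uncrossed arcs P := hP.1

/-- A point that an arc separates neither from `x` nor from `y`, which the arc separates, is an end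
of the arc. -/
theorem eq_end_of_crosses {e : V × V} {u x y : V} (hxy : Crosses e x y) (hx : ¬ Crosses e u x)
    (hy : ¬ Crosses e u y) : u = e.1 ∨ u = e.2 := by
  by_contra! h
  by_cases hu : u ∈ Ioo e.1 e.2
  · rcases hxy with ⟨-, h'⟩ | ⟨-, h'⟩
    · exact hy (Or.inl ⟨hu, h'⟩)
    · exact hx (Or.inl ⟨hu, h'⟩)
  · have hu' : u ∉ Icc e.1 e.2 := fun h' =>
      hu ⟨lt_of_le_of_ne h'.1 (Ne.symm h.1), lt_of_le_of_ne h'.2 h.2⟩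
    rcases hxy with ⟨h', -⟩ | ⟨h', -⟩
    · exact hx (Or.inr ⟨h', hu'⟩)
    · exact hy (Or.inr ⟨h', hu'⟩)

/-- Different subgons are separated by an arc. -/
theorem IsSubgon.exists_crosses_of_ne {P P' : Set V} (hP : IsSubgon arcs P)
    (hP' : IsSubgon arcs P') (hne : P ≠ P') :
    ∃ x ∈ P, ∃ x' ∈ P', ∃ e ∈ arcs, Crosses e x x' := by
  by_contra! h
  have hU : Uncrossed arcs (P ∪ P') := by
    rintro x (hx | hx) y (hy | hy) e he
    · exact hP.uncrossed x hx y hy e he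
    · exact h x hx y hy e he
    · exact fun hc => h y hy x hx e he hc.symm
    · exact hP'.uncrossed x hx y hy e he
  have h1 : P ∪ P' ⊆ P := hP.2 hU subset_union_left
  have h2 : P ∪ P' ⊆ P' := hP'.2 hU subset_union_right
  exact hne (Subset.antisymm (subset_union_left.trans h2) (subset_union_right.trans h1))

/-- Different subgons with two common vertices `u < v` are separated by the arc `(u, v)`. -/
theorem IsSubgon.exists_crosses_pair_of_ne (hArc : ∀ e ∈ arcs, e.1 < e.2) {P P' : Set V} {u v : V}
    (hP : IsSubgon arcs P) (hP' : IsSubgon arcs P') (huv : u < v)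
    (hu : u ∈ P) (hv : v ∈ P) (hu' : u ∈ P') (hv' : v ∈ P') (hne : P ≠ P') :
    (u, v) ∈ arcs ∧ ∃ x ∈ P, ∃ x' ∈ P', Crosses (u, v) x x' := by
  obtain ⟨x, hx, x', hx', e, he, hc⟩ := hP.exists_crosses_of_ne hP' hne
  have h1 := eq_end_of_crosses hc (hP.uncrossed u hu x hx e he) (hP'.uncrossed u hu' x' hx' e he)
  have h2 := eq_end_of_crosses hc (hP.uncrossed v hv x hx e he) (hP'.uncrossed v hv' x' hx' e he)
  have h3 := hArc e he
  have : e = (u, v) := by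
    rcases h1 with h1 | h1 <;> rcases h2 with h2 | h2
    · exact absurd (h1.trans h2.symm) huv.ne
    · exact Prod.ext h1.symm h2.symm
    · rw [h1, h2] at huv; exact absurd huv h3.asymm
    · exact absurd (h1.trans h2.symm) huv.ne
  subst this
  exact ⟨he, x, hx, x', hx', hc⟩

/-- If only finitely many arcs end at `u`, then `u` lies in finitely many subgons. -/
theorem finite_subgons_at {u : V} (hdeg : {e ∈ arcs | e.1 = u ∨ e.2 = u}.Finite) :
    {P : Set V | IsSubgon arcs P ∧ u ∈ P}.Finite := by
  -- A subgon at `u` is determined by which arcs at `u` have one of its vertices strictly beneath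
  -- them: an arc separating two subgons at `u` must end at `u`.
  refine Set.Finite.of_finite_image
    (f := fun P : Set V => {e ∈ {e ∈ arcs | e.1 = u ∨ e.2 = u} | (P ∩ Ioo e.1 e.2).Nonempty})
    (hdeg.finite_subsets.subset ?_) ?_
  · rintro _ ⟨P, -, rfl⟩
    exact sep_subset _ _
  · rintro P ⟨hP, hu⟩ P' ⟨hP', hu'⟩ heq
    by_contra hne
    obtain ⟨x, hx, x', hx', e, he, hc⟩ := hP.exists_crosses_of_ne hP' hne
    have h1 := eq_end_of_crosses hc (hP.uncrossed u hu x hx e he)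
      (hP'.uncrossed u hu' x' hx' e he)
    have hmem : e ∈ {e ∈ arcs | e.1 = u ∨ e.2 = u} := ⟨he, h1.imp Eq.symm Eq.symm⟩
    have hiff : (P ∩ Ioo e.1 e.2).Nonempty ↔ (P' ∩ Ioo e.1 e.2).Nonempty := by
      have := Set.ext_iff.1 heq e
      simpa [hmem.1, hmem.2] using this
    rcases hc with ⟨h2, h3⟩ | ⟨h2, h3⟩
    · obtain ⟨w, hw, hw'⟩ := hiff.1 ⟨x, hx, h2⟩
      exact hP'.uncrossed w hw x' hx' e he (Or.inl ⟨hw', h3⟩)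
    · obtain ⟨w, hw, hw'⟩ := hiff.2 ⟨x', hx', h2⟩
      exact hP.uncrossed w hw x hx e he (Or.inl ⟨hw', h3⟩)

/-- Under an uncrossed chord `(u, v)` that is not a boundary segment there is a point that is
separated neither from `u` nor from `v`. -/
theorem exists_uncrossed_between (hnc : ∀ e ∈ arcs, ∀ f ∈ arcs, ¬ Crosses e f.1 f.2) {u v : V}
    (hdeg : {e ∈ arcs | e.1 = u ∨ e.2 = u}.Finite) (hsucc : ∃ w, u ⋖ w)
    (huv : u < v) (hcov : ¬ u ⋖ v) (hun : ∀ e ∈ arcs, ¬ Crosses e u v) :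
    ∃ z ∈ Ioo u v, Uncrossed arcs {u, v, z} := by
  obtain ⟨s, hs⟩ := hsucc
  have hsv : s < v := lt_of_le_of_ne (hs.ge_of_gt huv) (fun h => hcov (h ▸ hs))
  -- The farthest neighbour of `u` before `v` works: an arc separating it from `v` would start at
  -- `u` and end farther on, still before `v`. The successor `s` makes the set nonempty.
  have hfin : {w | w ∈ Ioo u v ∧ ((u, w) ∈ arcs ∨ w = s)}.Finite := by
    refine ((hdeg.image Prod.snd).union (finite_singleton s)).subset ?_
    rintro w ⟨-, hw | hw⟩
    · exact Or.inl ⟨(u, w), ⟨hw, Or.inl rfl⟩, rfl⟩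
    · exact Or.inr hw
  obtain ⟨w, ⟨hw, hw'⟩, hmax⟩ := hfin.exists_maximal ⟨s, ⟨hs.lt, hsv⟩, Or.inr rfl⟩
  have huw : ∀ e ∈ arcs, ¬ Crosses e u w := by
    intro e he
    rcases hw' with h | rfl
    · exact hnc e he _ h
    · exact not_crosses_of_covBy hs e
  refine ⟨w, hw, uncrossed_triple hun huw ?_⟩
  rintro ⟨a, b⟩ he hc
  rcases eq_end_of_crosses hc (hun _ he) (huw _ he) with rfl | rfl
  · rcases hc with ⟨h1, h2⟩ | ⟨h1, h2⟩
    · exact h2 ⟨hw.1.le, (hw.2.trans h1.2).le⟩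
    · have hb : b < v := by
        by_contra hb
        exact h2 ⟨huv.le, not_lt.1 hb⟩
      have := hmax (y := b) ⟨⟨h1.1.trans h1.2, hb⟩, Or.inl he⟩ h1.2.le
      exact absurd h1.2 (not_lt.2 this)
  · rcases hc with ⟨h1, h2⟩ | ⟨h1, h2⟩
    · exact absurd h1.2 huv.asymm
    · exact absurd h1.2 hw.1.asymm

/-- Outside an uncrossed chord `(u, v)` there is a point that is separated neither from `u` nor from
`v`. -/
theorem exists_uncrossed_beyond (hnc : ∀ e ∈ arcs, ∀ f ∈ arcs, ¬ Crosses e f.1 f.2) {u v : V}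
    (hdeg : {e ∈ arcs | e.1 = u ∨ e.2 = u}.Finite) (hpred : ∃ w, w ⋖ u)
    (huv : u < v) (hun : ∀ e ∈ arcs, ¬ Crosses e u v) :
    ∃ z ∉ Icc u v, Uncrossed arcs {u, v, z} := by
  -- Turning around `u` away from `v`, the next neighbour is the nearest arc end past `v`; failing
  -- that, it is the leftmost neighbour before `u`, possibly the predecessor.
  by_cases hex : ∃ w, v < w ∧ (u, w) ∈ arcs
  · have hfin : {w | v < w ∧ (u, w) ∈ arcs}.Finite := by
      refine (hdeg.image Prod.snd).subset ?_
      rintro w ⟨-, hw⟩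
      exact ⟨(u, w), ⟨hw, Or.inl rfl⟩, rfl⟩
    obtain ⟨w, ⟨hw, hw'⟩, hmin⟩ := hfin.exists_minimal hex
    have huw : ∀ e ∈ arcs, ¬ Crosses e u w := fun e he => hnc e he _ hw'
    refine ⟨w, fun h => absurd hw (not_lt.2 h.2), uncrossed_triple hun huw ?_⟩
    rintro ⟨a, b⟩ he hc
    rcases eq_end_of_crosses hc (hun _ he) (huw _ he) with rfl | rfl
    · rcases hc with ⟨h1, h2⟩ | ⟨h1, h2⟩
      · have hb : b < w := by
          by_contra hb
          exact h2 ⟨(huv.trans hw).le, not_lt.1 hb⟩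
        exact absurd hb (not_lt.2 (hmin (y := b) ⟨h1.2, he⟩ hb.le))
      · exact h2 ⟨huv.le, (hw.trans h1.2).le⟩
    · rcases hc with ⟨h1, h2⟩ | ⟨h1, h2⟩
      · exact absurd h1.2 huv.asymm
      · exact absurd h1.2 (huv.trans hw).asymm
  · obtain ⟨s, hs⟩ := hpred
    have hfin : {w | w < u ∧ ((w, u) ∈ arcs ∨ w = s)}.Finite := by
      refine ((hdeg.image Prod.fst).union (finite_singleton s)).subset ?_
      rintro w ⟨-, hw | hw⟩
      · exact Or.inl ⟨(w, u), ⟨hw, Or.inr rfl⟩, rfl⟩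
      · exact Or.inr hw
    obtain ⟨w, ⟨hw, hw'⟩, hmin⟩ := hfin.exists_minimal ⟨s, hs.lt, Or.inr rfl⟩
    have huw : ∀ e ∈ arcs, ¬ Crosses e u w := by
      intro e he hc
      rcases hw' with h | rfl
      · exact hnc e he _ h hc.symm
      · exact not_crosses_of_covBy hs e hc.symm
    refine ⟨w, fun h => absurd hw (not_lt.2 h.1), uncrossed_triple hun huw ?_⟩
    rintro ⟨a, b⟩ he hc
    rcases eq_end_of_crosses hc (hun _ he) (huw _ he) with rfl | rfl
    · rcases hc with ⟨h1, h2⟩ | ⟨h1, h2⟩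
      · exact hex ⟨b, h1.2, he⟩
      · exact absurd h1.1 hw.asymm
    · rcases hc with ⟨h1, h2⟩ | ⟨h1, h2⟩
      · exact absurd h1.2 huv.asymm
      · exact absurd (hmin (y := a) ⟨h1.1.trans hw, Or.inl he⟩ h1.1.le) (not_le.2 h1.1)

end Subgons

/-! ### How often a pair is an edge of a subgon -/

section EdgeCount

variable {V : Type*} [LinearOrder V] {arcs : Set (V × V)}

/-- Two such subgons would be separated by `(u, v)` itself, putting a vertex of one of them strictly
between `u` and `v`. -/
theorem SpansOutside.eq (hArc : ∀ e ∈ arcs, e.1 < e.2) {P P' : Set V} {u v : V}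
    (hP : IsSubgon arcs P) (hP' : IsSubgon arcs P') (h : SpansOutside P u v)
    (h' : SpansOutside P' u v) : P = P' := by
  by_contra hne
  obtain ⟨-, x, hx, x', hx', hc⟩ := hP.exists_crosses_pair_of_ne hArc hP' h.1 h.2.1 h.2.2.1
    h'.2.1 h'.2.2.1 hne
  rcases hc with ⟨h1, -⟩ | ⟨h1, -⟩
  · exact h.2.2.2 x hx h1
  · exact h'.2.2.2 x' hx' h1

theorem SpansInside.eq (hArc : ∀ e ∈ arcs, e.1 < e.2) {P P' : Set V} {u v : V}
    (hP : IsSubgon arcs P) (hP' : IsSubgon arcs P') (h : SpansInside P u v)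
    (h' : SpansInside P' u v) : P = P' := by
  by_contra hne
  obtain ⟨-, x, hx, x', hx', hc⟩ := hP.exists_crosses_pair_of_ne hArc hP' h.1 h.2.1 h.2.2.1
    h'.2.1 h'.2.2.1 hne
  rcases hc with ⟨-, h1⟩ | ⟨-, h1⟩
  · exact h1 (h'.2.2.2 x' hx')
  · exact h1 (h.2.2.2 x hx)

/-- If `u`, `v` are not neighbours, an unseparated point between them gives a second subgon through
both, which forces the arc. Conversely, a point beyond the arc gives the subgon on its far side. -/
theorem exists_spansOutside_iff (hArc : ∀ e ∈ arcs, e.1 < e.2)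
    (hnc : ∀ e ∈ arcs, ∀ f ∈ arcs, ¬ Crosses e f.1 f.2) {u v : V}
    (hdeg : {e ∈ arcs | e.1 = u ∨ e.2 = u}.Finite) (hpred : ∃ w, w ⋖ u) (hsucc : ∃ w, u ⋖ w) :
    (∃ P, IsSubgon arcs P ∧ SpansOutside P u v) ↔ ((u, v) ∈ arcs ∨ u ⋖ v) := by
  constructor
  · rintro ⟨P, hP, huv, hu, hv, hPo⟩
    by_contra! h
    obtain ⟨z, hz, hU⟩ := exists_uncrossed_between hnc hdeg hsucc huv h.2 (hP.uncrossed u hu v hv)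
    obtain ⟨Q, hQ, hQs⟩ := hU.exists_subgon
    have hne : P ≠ Q := fun hPQ => hPo z (hPQ ▸ hQ (by simp)) hz
    exact h.1 (hP.exists_crosses_pair_of_ne hArc hQs huv hu hv (hQ (by simp)) (hQ (by simp)) hne).1
  · rintro (h | h)
    · obtain ⟨z, hz, hU⟩ := exists_uncrossed_beyond hnc hdeg hpred (hArc _ h)
        (fun e he => hnc e he _ h)
      obtain ⟨Q, hQ, hQs⟩ := hU.exists_subgon
      exact ⟨Q, hQs, hArc _ h, hQ (by simp), hQ (by simp), fun w hw hwi =>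
        hQs.uncrossed w hw z (hQ (by simp)) _ h (Or.inl ⟨hwi, hz⟩)⟩
    · obtain ⟨Q, hQ, hQs⟩ := (uncrossed_pair (fun e (_ : e ∈ arcs) =>
        not_crosses_of_covBy h e)).exists_subgon
      exact ⟨Q, hQs, h.lt, hQ (by simp), hQ (by simp), fun w _ hwi => h.2 hwi.1 hwi.2⟩

/-- Boundary segments drop out here, since some unseparated point always lies beyond them; this
asymmetry is what survives the cancellation. -/
theorem exists_spansInside_iff (hArc : ∀ e ∈ arcs, e.1 < e.2 ∧ ¬ e.1 ⋖ e.2)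
    (hnc : ∀ e ∈ arcs, ∀ f ∈ arcs, ¬ Crosses e f.1 f.2) {u v : V}
    (hdeg : {e ∈ arcs | e.1 = u ∨ e.2 = u}.Finite) (hpred : ∃ w, w ⋖ u) (hsucc : ∃ w, u ⋖ w) :
    (∃ P, IsSubgon arcs P ∧ SpansInside P u v) ↔ (u, v) ∈ arcs := by
  constructor
  · rintro ⟨P, hP, huv, hu, hv, hPi⟩
    by_contra h
    obtain ⟨z, hz, hU⟩ := exists_uncrossed_beyond hnc hdeg hpred huv (hP.uncrossed u hu v hv)
    obtain ⟨Q, hQ, hQs⟩ := hU.exists_subgon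
    have hne : P ≠ Q := fun hPQ => hz (hPi z (hPQ ▸ hQ (by simp)))
    exact h (hP.exists_crosses_pair_of_ne (fun e he => (hArc e he).1) hQs huv hu hv
      (hQ (by simp)) (hQ (by simp)) hne).1
  · intro h
    obtain ⟨z, hz, hU⟩ := exists_uncrossed_between hnc hdeg hsucc (hArc _ h).1 (hArc _ h).2
      (fun e he => hnc e he _ h)
    obtain ⟨Q, hQ, hQs⟩ := hU.exists_subgon
    refine ⟨Q, hQs, (hArc _ h).1, hQ (by simp), hQ (by simp), fun w hw => ?_⟩
    by_contra hwi
    exact hQs.uncrossed z (hQ (by simp)) w hw _ h (Or.inl ⟨hz, hwi⟩)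

open Classical in
theorem sum_ite_of_unique {α : Type*} (s : Finset α) (p : α → Prop) (c : ℝ)
    (huniq : ∀ a ∈ s, ∀ b ∈ s, p a → p b → a = b) :
    ∑ a ∈ s, (if p a then c else 0) = if ∃ a ∈ s, p a then c else 0 := by
  split_ifs with h
  · obtain ⟨a, ha, hpa⟩ := h
    rw [Finset.sum_eq_single_of_mem a ha, if_pos hpa]
    intro b hb hne
    rw [if_neg fun hpb => hne (huniq b hb a ha hpb hpa)]
  · refine Finset.sum_eq_zero fun a ha => if_neg fun hpa => h ⟨a, ha, hpa⟩

end EdgeCount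

/-! ### Gluing the polygon forms -/

section QuadraticForm

variable {V : Type*} [LinearOrder V] {T : V → V}

/-- Around `u` there are finitely many arcs, and `u` has neighbours on the boundary on both sides. -/
structure IsRegularVertex (arcs : Set (V × V)) (u : V) : Prop where
  finite_arcs : {e ∈ arcs | e.1 = u ∨ e.2 = u}.Finite
  exists_pred : ∃ w, w ⋖ u
  exists_succ : ∃ w, u ⋖ w

open Classical in
theorem sum_eq_sum_ite_mem (P S : Finset V) (h : V → ℝ) (h0 : ∀ v ∉ S, h v = 0) :
    ∑ v ∈ P, h v = ∑ v ∈ S, if v ∈ P then h v else 0 := by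
  rw [Finset.sum_ite_mem, Finset.inter_comm]
  symm
  refine Finset.sum_subset Finset.inter_subset_left fun v hv hv' => h0 v fun hS => hv' ?_
  exact Finset.mem_inter.2 ⟨hv, hS⟩

-- The polygon inequality with its sums moved to a set `S` supporting `y`, so that all subgons share
-- one index set.
open Classical in
theorem StripDissection.subgon_form_nonneg (D : StripDissection T) (S : Finset V)
    (hS : ∀ u ∈ S, IsRegularVertex D.arcs u) (y : V → ℝ) (hy : ∀ v ∉ S, y v = 0)
    {P : Set V} (hP : IsSubgon D.arcs P) (hPS : ∃ u ∈ S, u ∈ P) :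
    0 ≤ ∑ u ∈ S, (if u ∈ P then lam P.ncard * y u ^ 2 else 0)
      - 2 * ∑ u ∈ S, ∑ v ∈ S, (if SpansOutside P u v then y u * y v else 0)
      + 2 * ∑ u ∈ S, ∑ v ∈ S, (if SpansInside P u v then y u * y v else 0) := by
  obtain ⟨u, huS, hu⟩ := hPS
  obtain ⟨P, rfl⟩ := (D.polygons P hP).exists_finset_coe
  -- No arc separates `u` from its successor, so a single point is not maximal.
  have hcard : 2 ≤ P.card := by
    by_contra! hlt
    obtain ⟨w, hw⟩ := (hS u huS).exists_succ
    have h1 : ∀ x ∈ P, x = u := fun x hx =>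
      Finset.card_le_one.1 (by omega) x hx u hu
    have h2 : Uncrossed D.arcs {u, w} := uncrossed_pair fun e _ => not_crosses_of_covBy hw e
    have h3 := hP.2 h2 (by
      intro x hx
      exact Or.inl (h1 x hx))
    have h4 : w ∈ (P : Set V) := h3 (by simp)
    exact hw.lt.ne (h1 w h4).symm
  have h := polygon_form_nonneg P hcard y
  have e1 : lam P.card * ∑ v ∈ P, y v ^ 2
      = ∑ u ∈ S, (if u ∈ (P : Set V) then lam (P : Set V).ncard * y u ^ 2 else 0) := by
    rw [Finset.mul_sum, sum_eq_sum_ite_mem P S _ (fun v hv => by rw [hy v hv]; ring),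
      Set.ncard_coe_finset]
    rfl
  have e2 : ∀ R : V → V → Prop, (∀ u v, R u v → u ∈ P ∧ v ∈ P) →
      ∑ u ∈ P, ∑ v ∈ P, (if R u v then y u * y v else 0)
        = ∑ u ∈ S, ∑ v ∈ S, (if R u v then y u * y v else 0) := by
    intro R hR
    rw [sum_eq_sum_ite_mem P S _ (fun v hv => by simp [hy v hv])]
    refine Finset.sum_congr rfl fun a _ => ?_
    split_ifs with ha
    · rw [sum_eq_sum_ite_mem P S _ (fun v hv => by simp [hy v hv])]
      refine Finset.sum_congr rfl fun b _ => ?_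
      split_ifs with h1 h2 h2
      · rfl
      · rfl
      · exact absurd (hR _ _ h2).2 h1
      · rfl
    · symm
      refine Finset.sum_eq_zero fun b _ => if_neg fun hab => ha (hR _ _ hab).1
  rw [e1, e2 _ (fun u v h => ⟨h.2.1, h.2.2.1⟩), e2 _ (fun u v h => ⟨h.2.1, h.2.2.1⟩)] at h
  convert h

open Classical in
/-- The quadratic form of the second order recurrence defined by the quiddity of a dissection is
positive semidefinite. -/
theorem StripDissection.quadraticForm_nonneg (D : StripDissection T) (S : Finset V)
    (hS : ∀ u ∈ S, IsRegularVertex D.arcs u) (y : V → ℝ) (hy : ∀ v ∉ S, y v = 0) :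
    0 ≤ ∑ u ∈ S, D.quiddity u * y u ^ 2
      - 2 * ∑ u ∈ S, ∑ v ∈ S, (if u ⋖ v then y u * y v else 0) := by
  have hfin : {P : Set V | IsSubgon D.arcs P ∧ ∃ u ∈ S, u ∈ P}.Finite := by
    refine (S.finite_toSet.biUnion (t := fun u => {P : Set V | IsSubgon D.arcs P ∧ u ∈ P})
      fun u hu => finite_subgons_at (hS u hu).finite_arcs).subset ?_
    rintro P ⟨hP, u, hu, huP⟩
    exact mem_biUnion (x := u) hu ⟨hP, huP⟩
  set Ps := hfin.toFinset with hPs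
  have hmem : ∀ P, P ∈ Ps ↔ IsSubgon D.arcs P ∧ ∃ u ∈ S, u ∈ P := by
    intro P; simp [hPs]
  have hquid : ∀ u ∈ S, D.quiddity u = ∑ P ∈ Ps, if u ∈ P then lam P.ncard else 0 := by
    intro u hu
    have : {P : Set V | IsSubgon D.arcs P ∧ u ∈ P} = ↑(Ps.filter (u ∈ ·)) := by
      ext P
      simp only [mem_ofPred_eq, Finset.coe_filter, hmem]
      constructor
      · rintro ⟨h1, h2⟩
        exact ⟨⟨h1, u, hu, h2⟩, h2⟩
      · rintro ⟨⟨h1, -⟩, h2⟩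
        exact ⟨h1, h2⟩
    rw [StripDissection.quiddity, this, finsum_mem_coe_finset, Finset.sum_filter]
  have hArc : ∀ e ∈ D.arcs, e.1 < e.2 := fun e he => (D.isArc e he).1
  have hdiag : ∑ u ∈ S, D.quiddity u * y u ^ 2
      = ∑ P ∈ Ps, ∑ u ∈ S, (if u ∈ P then lam P.ncard * y u ^ 2 else 0) := by
    rw [Finset.sum_comm]
    refine Finset.sum_congr rfl fun u hu => ?_
    rw [hquid u hu, Finset.sum_mul]
    refine Finset.sum_congr rfl fun P _ => ?_
    rw [ite_mul, zero_mul]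
  have hswap : ∀ R : Set V → V → V → Prop,
      ∑ P ∈ Ps, ∑ u ∈ S, ∑ v ∈ S, (if R P u v then y u * y v else 0)
        = ∑ u ∈ S, ∑ v ∈ S, ∑ P ∈ Ps, (if R P u v then y u * y v else 0) := by
    intro R
    rw [Finset.sum_comm]
    exact Finset.sum_congr rfl fun u _ => Finset.sum_comm
  -- For each pair, an arc counts `1 - 1`, a boundary segment `1 - 0`, any other pair `0 - 0`.
  have hedge : ∑ u ∈ S, ∑ v ∈ S, (if u ⋖ v then y u * y v else 0)
      = ∑ P ∈ Ps, ∑ u ∈ S, ∑ v ∈ S, (if SpansOutside P u v then y u * y v else 0)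
        - ∑ P ∈ Ps, ∑ u ∈ S, ∑ v ∈ S, (if SpansInside P u v then y u * y v else 0) := by
    rw [hswap, hswap, ← Finset.sum_sub_distrib]
    refine Finset.sum_congr rfl fun u hu => ?_
    rw [← Finset.sum_sub_distrib]
    refine Finset.sum_congr rfl fun v _ => ?_
    obtain ⟨hdeg, hpred, hsucc⟩ := hS u hu
    rw [sum_ite_of_unique Ps (fun P => SpansOutside P u v) _ (fun P hP Q hQ h h' =>
        h.eq hArc ((hmem P).1 hP).1 ((hmem Q).1 hQ).1 h'),
      sum_ite_of_unique Ps (fun P => SpansInside P u v) _ (fun P hP Q hQ h h' =>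
        h.eq hArc ((hmem P).1 hP).1 ((hmem Q).1 hQ).1 h')]
    have h1 : (∃ P ∈ Ps, SpansOutside P u v) ↔ ((u, v) ∈ D.arcs ∨ u ⋖ v) := by
      rw [← exists_spansOutside_iff hArc D.noncrossing hdeg hpred hsucc]
      exact exists_congr fun P => ⟨fun h => ⟨((hmem P).1 h.1).1, h.2⟩,
        fun h => ⟨(hmem P).2 ⟨h.1, u, hu, h.2.2.1⟩, h.2⟩⟩
    have h2 : (∃ P ∈ Ps, SpansInside P u v) ↔ (u, v) ∈ D.arcs := by
      rw [← exists_spansInside_iff D.isArc D.noncrossing hdeg hpred hsucc]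
      exact exists_congr fun P => ⟨fun h => ⟨((hmem P).1 h.1).1, h.2⟩,
        fun h => ⟨(hmem P).2 ⟨h.1, u, hu, h.2.2.1⟩, h.2⟩⟩
    simp only [h1, h2]
    by_cases harc : (u, v) ∈ D.arcs
    · have hc : ¬ u ⋖ v := (D.isArc _ harc).2
      simp [harc, hc]
    · simp [harc]
  rw [hdiag, hedge]
  have hsum : 0 ≤ ∑ P ∈ Ps, (∑ u ∈ S, (if u ∈ P then lam P.ncard * y u ^ 2 else 0)
      - 2 * ∑ u ∈ S, ∑ v ∈ S, (if SpansOutside P u v then y u * y v else 0)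
      + 2 * ∑ u ∈ S, ∑ v ∈ S, (if SpansInside P u v then y u * y v else 0)) :=
    Finset.sum_nonneg fun P hP =>
      D.subgon_form_nonneg S hS y hy ((hmem P).1 hP).1 ((hmem P).1 hP).2
  rw [Finset.sum_add_distrib, Finset.sum_sub_distrib, ← Finset.mul_sum, ← Finset.mul_sum] at hsum
  linarith

/-- The quadratic form along a boundary component `ι`. -/
theorem StripDissection.boundary_form_nonneg (D : StripDissection T) {ι : ℤ → V}
    (hι : StrictMono ι) (hcov : ∀ i, ι i ⋖ ι (i + 1))
    (hdeg : ∀ i, {e ∈ D.arcs | e.1 = ι i ∨ e.2 = ι i}.Finite) (i : ℤ) (N : ℕ) (z : ℕ → ℝ) :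
    0 ≤ ∑ k ∈ Finset.range (N + 1), D.quiddity (ι (i + k)) * z k ^ 2
      - 2 * ∑ k ∈ Finset.range N, z k * z (k + 1) := by
  classical
  set w : ℕ → V := fun k => ι (i + k) with hw
  have hwinj : Function.Injective w := fun a b hab => by
    have := hι.injective hab
    omega
  set y : V → ℝ := Function.extend w (fun k => if k < N + 1 then z k else 0) 0 with hydef
  have hyw : ∀ k < N + 1, y (w k) = z k := fun k hk => by
    rw [hydef, hwinj.extend_apply, if_pos hk]
  have h := D.quadraticForm_nonneg ((Finset.range (N + 1)).image w) (by
      intro u hu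
      obtain ⟨k, -, rfl⟩ := Finset.mem_image.1 hu
      refine ⟨hdeg _, ⟨ι (i + k - 1), ?_⟩, ⟨_, hcov _⟩⟩
      have := hcov (i + k - 1)
      rwa [sub_add_cancel] at this) y (by
      intro v hv
      by_cases hex : ∃ k, w k = v
      · obtain ⟨k, rfl⟩ := hex
        rw [hydef, hwinj.extend_apply, if_neg]
        exact fun hk => hv (Finset.mem_image_of_mem _ (Finset.mem_range.2 hk))
      · rw [hydef, Function.extend_apply' _ _ _ hex]; rfl)
  have hcw : ∀ a b, w a ⋖ w b ↔ b = a + 1 := by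
    intro a b
    constructor
    · intro hab
      have h1 := (hcov (i + a)).unique_right hab
      have := hι.injective h1
      omega
    · rintro rfl
      have := hcov (i + a)
      rw [hw]; push_cast; rwa [← add_assoc]
  rw [Finset.sum_image hwinj.injOn, Finset.sum_image hwinj.injOn] at h
  simp only [Finset.sum_image hwinj.injOn, hcw, Finset.sum_ite_eq', Finset.mem_range] at h
  rw [Finset.sum_range_succ _ N, Finset.sum_range_succ _ N, if_neg (by omega), add_zero] at h
  rw [Finset.sum_range_succ _ N]
  convert h using 2
  · congr 1
    · refine Finset.sum_congr rfl fun k hk => ?_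
      rw [hyw k (by have := Finset.mem_range.1 hk; omega)]
    · rw [hyw N (by omega)]
  · congr 1
    refine Finset.sum_congr rfl fun k hk => ?_
    have := Finset.mem_range.1 hk
    rw [if_pos (by omega), hyw k (by omega), hyw (k + 1) (by omega)]

end QuadraticForm

/-! ### Continuants and the frieze -/

section Continuant

/-- The solution of `x (k + 1) = a k * x k - x (k - 1)` with values `0` and `1` at `i` and `i + 1`,
as a function of `k - i`. -/
def continuant (a : ℤ → ℝ) (i : ℤ) : ℕ → ℝ
  | 0 => 0
  | 1 => 1
  | d + 2 => a (i + (d + 1 : ℕ)) * continuant a i (d + 1) - continuant a i d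

theorem continuant_add_two (a : ℤ → ℝ) (i : ℤ) (d : ℕ) : continuant a i (d + 2)
    = a (i + (d + 1 : ℕ)) * continuant a i (d + 1) - continuant a i d := rfl

/-- This is the Wronskian of two solutions of one recurrence, hence constant in `d`. -/
theorem continuant_unimodular (a : ℤ → ℝ) (i : ℤ) (d : ℕ) :
    continuant a (i - 1) (d + 1) * continuant a i (d + 1)
      - continuant a i d * continuant a (i - 1) (d + 2) = 1 := by
  induction d with
  | zero => simp [continuant]
  | succ d ih =>
    rw [continuant_add_two a (i - 1) (d + 1), continuant_add_two a i d]
    have : i - 1 + ((d + 1 + 1 : ℕ) : ℤ) = i + ((d + 1 : ℕ) : ℤ) := by push_cast; ring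
    rw [this]
    linear_combination ih

/-- Multiply the recurrence by the current term and sum: only the last product remains, because the
initial value is `0`. -/
theorem continuant_energy (a : ℤ → ℝ) (i : ℤ) (d : ℕ) :
    ∑ k ∈ Finset.range (d + 1), a (i + 1 + k) * continuant a i (k + 1) ^ 2
      - 2 * ∑ k ∈ Finset.range d, continuant a i (k + 1) * continuant a i (k + 2)
      = continuant a i (d + 1) * continuant a i (d + 2) := by
  induction d with
  | zero => simp [continuant]
  | succ d ih =>
    rw [Finset.sum_range_succ _ (d + 1),
      Finset.sum_range_succ (fun k => continuant a i (k + 1) * continuant a i (k + 2)) d,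
      continuant_add_two a i (d + 1)]
    have : i + 1 + ((d + 1 : ℕ) : ℤ) = i + ((d + 1 + 1 : ℕ) : ℤ) := by push_cast; ring
    rw [this]
    linear_combination ih

/-- If the quadratic form of the recurrence is positive semidefinite, then the continuants are
positive. -/
theorem continuant_pos {a : ℤ → ℝ}
    (h : ∀ (i : ℤ) (N : ℕ) (z : ℕ → ℝ),
      0 ≤ ∑ k ∈ Finset.range (N + 1), a (i + k) * z k ^ 2
        - 2 * ∑ k ∈ Finset.range N, z k * z (k + 1)) (i : ℤ) (d : ℕ) :
    0 < continuant a i (d + 1) := by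
  induction d with
  | zero => simp [continuant]
  | succ d ih =>
    by_contra! hneg
    set g := continuant a i (d + 1) with hg
    set α := a (i + 1 + (d + 1 : ℕ)) with hα
    -- Test vector: the continuants up to `g`, then a free last entry `t`.
    have hform : ∀ t : ℝ, 0 ≤ g * continuant a i (d + 2) + α * t ^ 2 - 2 * (g * t) := by
      intro t
      have h1 := h (i + 1) (d + 1) (fun k => if k < d + 1 then continuant a i (k + 1) else t)
      rw [Finset.sum_range_succ _ (d + 1),
        Finset.sum_range_succ (fun k => (if k < d + 1 then continuant a i (k + 1) else t)
          * (if k + 1 < d + 1 then continuant a i (k + 1 + 1) else t)) d] at h1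
      have e1 : ∑ k ∈ Finset.range (d + 1),
          a (i + 1 + k) * (if k < d + 1 then continuant a i (k + 1) else t) ^ 2
          = ∑ k ∈ Finset.range (d + 1), a (i + 1 + k) * continuant a i (k + 1) ^ 2 :=
        Finset.sum_congr rfl fun k hk => by rw [if_pos (Finset.mem_range.1 hk)]
      have e2 : ∑ k ∈ Finset.range d, (if k < d + 1 then continuant a i (k + 1) else t)
            * (if k + 1 < d + 1 then continuant a i (k + 1 + 1) else t)
          = ∑ k ∈ Finset.range d, continuant a i (k + 1) * continuant a i (k + 2) :=
        Finset.sum_congr rfl fun k hk => by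
          have := Finset.mem_range.1 hk
          rw [if_pos (by omega), if_pos (by omega)]
      rw [e1, e2, if_neg (by omega), if_pos (by omega)] at h1
      have h2 := continuant_energy a i d
      linarith
    -- With `t = g / (|α| + 1)` one has `g * t = (|α| + 1) * t ^ 2`, so the linear term beats `α * t
    -- ^ 2` and the form becomes negative.
    have hα0 : 0 < |α| + 1 := by positivity
    have h1 := hform (g / (|α| + 1))
    have ht : 0 < g / (|α| + 1) := div_pos ih hα0
    have hgt : g = (g / (|α| + 1)) * (|α| + 1) := by field_simp
    generalize g / (|α| + 1) = t at *
    have h2 : g * continuant a i (d + 2) ≤ 0 := mul_nonpos_of_nonneg_of_nonpos ih.le hneg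
    have h3 : α * t ^ 2 ≤ |α| * t ^ 2 := by gcongr; exact le_abs_self α
    have h4 : g * t = |α| * t ^ 2 + t ^ 2 := by rw [hgt]; ring
    have h5 : 0 ≤ |α| * t ^ 2 := by positivity
    have h6 : 0 < t ^ 2 := by positivity
    linarith

/-- An infinite frieze whose first nontrivial row has positive continuants consists of them. -/
theorem IsInfiniteFrieze.eq_continuant {F : ℤ → ℤ → ℝ} (hF : IsInfiniteFrieze F) {a : ℤ → ℝ}
    (ha : ∀ i, F (i - 1) (i + 1) = a i) (hpos : ∀ i d, 0 < continuant a i (d + 1)) (d : ℕ) :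
    ∀ i, F i (i + d) = continuant a i d := by
  induction d using Nat.strong_induction_on with
  | _ d ih =>
    intro i
    match d, ih with
    | 0, _ => simpa [continuant] using hF.zero_row i
    | 1, _ => simpa [continuant] using hF.one_row i
    | 2, _ =>
      have := ha (i + 1)
      rw [add_sub_cancel_right, add_assoc] at this
      simpa [continuant] using this
    | d + 3, ih =>
      -- Frieze and continuants obey the same diamond rule and agree on the other three corners; the
      -- bottom corner agrees because its coefficient, the top one, is nonzero.
      have hu := hF.unimodular (i + 1) (i + 1 + (d + 1 : ℕ)) (by omega)
      have hc := continuant_unimodular a (i + 1) (d + 1)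
      rw [add_sub_cancel_right] at hu hc
      have h1 := ih (d + 2) (by omega) i
      have h2 := ih (d + 2) (by omega) (i + 1)
      have h3 := ih (d + 1) (by omega) (i + 1)
      have r1 : i + 1 + ((d + 1 : ℕ) : ℤ) = i + (d + 2 : ℕ) := by push_cast; ring
      have r2 : i + ((d + 2 : ℕ) : ℤ) + 1 = i + 1 + (d + 2 : ℕ) := by push_cast; ring
      have r3 : i + 1 + ((d + 2 : ℕ) : ℤ) = i + (d + 3 : ℕ) := by push_cast; ring
      rw [h3, r1, r2, h1, h2, r3] at hu
      have hp := hpos (i + 1) d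
      refine mul_left_cancel₀ hp.ne' ?_
      linear_combination hc - hu

theorem IsInfiniteFrieze.pos {F : ℤ → ℤ → ℝ} (hF : IsInfiniteFrieze F) {V : Type*} [LinearOrder V]
    {T : V → V} (D : StripDissection T) {ι : ℤ → V}
    (hι : StrictMono ι) (hcov : ∀ i, ι i ⋖ ι (i + 1))
    (hdeg : ∀ i, {e ∈ D.arcs | e.1 = ι i ∨ e.2 = ι i}.Finite)
    (hq : ∀ i, F (i - 1) (i + 1) = D.quiddity (ι i)) {i j : ℤ} (hij : i < j) : 0 < F i j := by
  have hpos := continuant_pos (a := fun i => D.quiddity (ι i))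
    (fun i N z => D.boundary_form_nonneg hι hcov hdeg i N z)
  obtain ⟨d, rfl⟩ : ∃ d : ℕ, j = i + (d + 1 : ℕ) := ⟨(j - i - 1).toNat, by omega⟩
  rw [hF.eq_continuant hq hpos]
  exact hpos i d

end Continuant

/-! ### Local finiteness for the annulus and the punctured disc -/

section Surfaces

theorem outer_strictMono : StrictMono AnnulusPoint.outer := fun _ _ h =>
  Sum.Lex.inl_lt_inl_iff.2 h

theorem outer_covBy (i : ℤ) : AnnulusPoint.outer i ⋖ AnnulusPoint.outer (i + 1) := by
  refine ⟨outer_strictMono (by omega), fun c h1 h2 => ?_⟩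
  rcases c with c | c
  · have h1' : i < c := Sum.Lex.inl_lt_inl_iff.1 h1
    have h2' : c < i + 1 := Sum.Lex.inl_lt_inl_iff.1 h2
    omega
  · exact absurd h2 Sum.Lex.not_inr_lt_inl

theorem crosses_of_lt {V : Type*} [LinearOrder V] {x x' y y' : V} (h1 : x < x') (h2 : x' < y)
    (h3 : y < y') : Crosses (x, y) x' y' :=
  Or.inl ⟨⟨h1, h2⟩, fun h => absurd h3 (not_lt.2 h.2)⟩

theorem inner_lt_inner {j j' : ℤ} (h : j' < j) : AnnulusPoint.inner j < AnnulusPoint.inner j' :=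
  Sum.Lex.inr_lt_inr_iff.2 (OrderDual.toDual_lt_toDual.2 h)

theorem outer_lt_inner (i j : ℤ) : AnnulusPoint.outer i < AnnulusPoint.inner j :=
  Sum.Lex.inl_lt_inr _ _

/-- A longer arc would cross its own translate. -/
theorem AnnulusDissection.outer_arc_le {n m : ℕ} (hn : 1 ≤ n) (D : AnnulusDissection n m) {a b : ℤ}
    (h : (AnnulusPoint.outer a, AnnulusPoint.outer b) ∈ D.arcs) : a ≤ b ∧ b ≤ a + n := by
  refine ⟨(outer_strictMono.lt_iff_lt.1 (D.isArc _ h).1).le, ?_⟩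
  by_contra! hlt
  have h' : (AnnulusPoint.outer (a + n), AnnulusPoint.outer (b + n)) ∈ D.arcs :=
    (D.periodic _ _).2 h
  exact D.noncrossing _ h _ h' (crosses_of_lt (outer_strictMono (by omega))
    (outer_strictMono hlt) (outer_strictMono (by omega)))

/-- Otherwise the second arc would cross the translate of the first; so the inner ends of the arcs
at one outer vertex stay in a bounded window. -/
theorem AnnulusDissection.inner_arc_le {n m : ℕ} (hn : 1 ≤ n) (D : AnnulusDissection n m)
    {i j j' : ℤ} (h : (AnnulusPoint.outer i, AnnulusPoint.inner j) ∈ D.arcs)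
    (h' : (AnnulusPoint.outer i, AnnulusPoint.inner j') ∈ D.arcs) : j' ≤ j + m := by
  by_contra! hlt
  have hT : (AnnulusPoint.outer (i + n), AnnulusPoint.inner (j + m)) ∈ D.arcs :=
    (D.periodic _ _).2 h
  exact D.noncrossing _ h' _ hT (crosses_of_lt (outer_strictMono (by omega))
    (outer_lt_inner _ _) (inner_lt_inner hlt))

theorem AnnulusDissection.finite_arcs_outer {n m : ℕ} (hn : 1 ≤ n) (D : AnnulusDissection n m)
    (i : ℤ) :
    {e ∈ D.arcs | e.1 = AnnulusPoint.outer i ∨ e.2 = AnnulusPoint.outer i}.Finite := by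
  have hinner : {k | (AnnulusPoint.outer i, AnnulusPoint.inner k) ∈ D.arcs}.Finite := by
    rcases Set.eq_empty_or_nonempty {k | (AnnulusPoint.outer i, AnnulusPoint.inner k) ∈ D.arcs}
      with h | ⟨j, hj⟩
    · rw [h]; exact finite_empty
    · refine (finite_Icc (j - m) (j + m)).subset fun k hk => ⟨?_, D.inner_arc_le hn hj hk⟩
      have := D.inner_arc_le hn hk hj
      omega
  refine ((((finite_Icc i (i + n)).image
    fun k => (AnnulusPoint.outer i, AnnulusPoint.outer k)).union
      ((finite_Icc (i - n) i).image fun k => (AnnulusPoint.outer k, AnnulusPoint.outer i))).union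
      (hinner.image fun k => (AnnulusPoint.outer i, AnnulusPoint.inner k))).subset ?_
  rintro ⟨x, y⟩ ⟨he, hx | hy⟩
  · obtain rfl : x = AnnulusPoint.outer i := hx
    rcases y with k | k
    · exact Or.inl (Or.inl ⟨k, D.outer_arc_le hn he, rfl⟩)
    · exact Or.inr ⟨OrderDual.ofDual k, he, rfl⟩
  · obtain rfl : y = AnnulusPoint.outer i := hy
    rcases x with k | k
    · have := D.outer_arc_le hn he
      exact Or.inl (Or.inr ⟨k, ⟨by omega, by omega⟩, rfl⟩)
    · exact absurd (D.isArc _ he).1 Sum.Lex.not_inr_lt_inl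

theorem PuncturedDiscDissection.arc_le {n : ℕ} (hn : 1 ≤ n) (D : PuncturedDiscDissection n)
    {a b : ℤ} (h : ((a : WithTop ℤ), (b : WithTop ℤ)) ∈ D.arcs) : a ≤ b ∧ b ≤ a + n := by
  refine ⟨(WithTop.coe_lt_coe.1 (D.isArc _ h).1).le, ?_⟩
  by_contra! hlt
  have h' : (((a + n : ℤ) : WithTop ℤ), ((b + n : ℤ) : WithTop ℤ)) ∈ D.arcs :=
    (D.periodic _ _).2 h
  exact D.noncrossing _ h _ h' (crosses_of_lt (WithTop.coe_lt_coe.2 (by omega))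
    (WithTop.coe_lt_coe.2 hlt) (WithTop.coe_lt_coe.2 (by omega)))

theorem PuncturedDiscDissection.finite_arcs_coe {n : ℕ} (hn : 1 ≤ n)
    (D : PuncturedDiscDissection n) (i : ℤ) :
    {e ∈ D.arcs | e.1 = (i : WithTop ℤ) ∨ e.2 = (i : WithTop ℤ)}.Finite := by
  refine ((((finite_Icc i (i + n)).image
    fun k : ℤ => ((i : WithTop ℤ), (k : WithTop ℤ))).union
      ((finite_Icc (i - n) i).image fun k : ℤ => ((k : WithTop ℤ), (i : WithTop ℤ)))).union
      (finite_singleton ((i : WithTop ℤ), ⊤))).subset ?_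
  rintro ⟨x, y⟩ ⟨he, hx | hy⟩
  · obtain rfl : x = i := hx
    induction y using WithTop.recTopCoe with
    | top => exact Or.inr rfl
    | coe k => exact Or.inl (Or.inl ⟨k, D.arc_le hn he, rfl⟩)
  · obtain rfl : y = i := hy
    induction x using WithTop.recTopCoe with
    | top => exact absurd (D.isArc _ he).1 not_top_lt
    | coe k =>
      have := D.arc_le hn he
      exact Or.inl (Or.inr ⟨k, ⟨by omega, by omega⟩, rfl⟩)

end Surfaces

theorem mainTheorem11 :
    (∀ n m : ℕ, 1 ≤ n → 1 ≤ m → ∀ (D : AnnulusDissection n m) (F : ℤ → ℤ → ℝ),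
      IsFriezeOfAnnulus D F → ∀ i j : ℤ, i < j → 0 < F i j) ∧
    (∀ n : ℕ, 1 ≤ n → ∀ (D : PuncturedDiscDissection n) (F : ℤ → ℤ → ℝ),
      IsFriezeOfPuncturedDisc D F → ∀ i j : ℤ, i < j → 0 < F i j) := by
  refine ⟨fun n m hn _ D F hF i j hij => ?_, fun n hn D F hF i j hij => ?_⟩
  · exact hF.1.pos D outer_strictMono outer_covBy (D.finite_arcs_outer hn) hF.2 hij
  · exact hF.1.pos D (ι := fun i : ℤ => (i : WithTop ℤ)) WithTop.coe_strictMono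
      (fun i => WithTop.coe_covBy_coe.2 (Order.covBy_add_one i)) (D.finite_arcs_coe hn) hF.2 hij
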